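/- Let $\Bbbk$ be a field of characteristic $0$. For a $\Bbbk$-algebra $A$ with center $Z(A)$, let $\mathrm{Oz}(A)$ (the ozone group of $A$) be the group of all $\Bbbk$-algebra automorphisms $\sigma$ of $A$ such that $\sigma(c)=c$ for every $c\in Z(A)$. For $q\in\Bbbk^\times$ with $q^3\neq 1$ let \[ B_q=\Bbbk\langle x,y,z\rangle/(xy-q\,yx,\; zx-q\,xz-y^2,\; zy-q^{-1}yz-x^2). \] **Proposition 1.7.** Let $q\in\Bbbk$ be a primitive $n$th root of unity, where $n\ge 1$ and $n\neq 1,3$. 1. If $3\nmid n$, then $\mathrm{Oz}(B_q)$ is trivial. 2. If $3\mid n$, then $\mathrm{Oz}(B_q)\cong \mathbb{Z}/3\mathbb{Z}\times\mathbb{Z}/3\mathbb{Z}$. -/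

import Mathlib

/-- The Galois group `Gal(A/C)` of a `k`-algebra `A` over a subalgebra `C` (used for `C` central):
the group of all `k`-algebra automorphisms of `A` that fix every element of `C`. -/
def galoisGroup {k A : Type*} [CommRing k] [Ring A] [Algebra k A] (C : Subalgebra k A) :
    Subgroup (A ≃ₐ[k] A) where
  carrier := {φ | ∀ c ∈ C, φ c = c}
  one_mem' := fun _ _ => rfl
  mul_mem' := by
    intro φ ψ hφ hψ c hc
    rw [AlgEquiv.mul_apply, hψ c hc, hφ c hc]
  inv_mem' := by
    intro φ hφ c hc
    have h : φ.symm (φ c) = c := φ.symm_apply_apply c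
    rw [hφ c hc] at h
    exact h

/-- The ozone group `Oz(A)`: the Galois group of `A` over its center. -/
def ozoneGroup (k A : Type*) [CommRing k] [Ring A] [Algebra k A] : Subgroup (A ≃ₐ[k] A) :=
  galoisGroup (Subalgebra.center k A)

namespace AlgB

/-- The generators `x, y, z` of the free algebra `k⟨x, y, z⟩`. -/
def X (k : Type*) [Field k] : FreeAlgebra k (Fin 3) := FreeAlgebra.ι k 0

/-- See `AlgB.X`. -/
def Y (k : Type*) [Field k] : FreeAlgebra k (Fin 3) := FreeAlgebra.ι k 1

/-- See `AlgB.X`. -/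
def Z (k : Type*) [Field k] : FreeAlgebra k (Fin 3) := FreeAlgebra.ι k 2

/-- The defining relations `xy = q yx`, `zx = q xz + y²`, `zy = q⁻¹ yz + x²`. -/
inductive Rel {k : Type*} [Field k] (q : k) :
    FreeAlgebra k (Fin 3) → FreeAlgebra k (Fin 3) → Prop
  | xy : Rel q (X k * Y k) (q • (Y k * X k))
  | zx : Rel q (Z k * X k) (q • (X k * Z k) + Y k ^ 2)
  | zy : Rel q (Z k * Y k) (q⁻¹ • (Y k * Z k) + X k ^ 2)

end AlgB

/-- The algebra `B_q = k⟨x, y, z⟩ / (xy - q yx, zx - q xz - y², zy - q⁻¹ yz - x²)`,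
for `q ≠ 0` with `q³ ≠ 1`. -/
abbrev AlgB {k : Type*} [Field k] (q : k) : Type _ := RingQuot (AlgB.Rel q)

/-! Take the quantum torus in `x, y` and adjoin an invertible central variable `t`. For suitable
constants α, β, sending `z` to `t x⁻¹y⁻¹ + α x²y⁻¹ + β x⁻¹y²` embeds `B_q`: with `t` most
significant, leading exponents separate the spanning monomials (`embed_injective`). The torus is
graded by an ordered group, so a root of a homogeneous element is homogeneous
(`eq_mon_of_pow_eq_mon`).

The elements `xⁿ`, `yⁿ` and `cubic`, whose image is `q t`, are central. An ozone automorphism fixes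
`xⁿ` and `yⁿ`, so it scales `x` by some `a` and `y` by some `b`; fixing `cubic` then forces `a³ = b³
= 1` and determines the image of `z` (`exists_of_mem_ozoneGroup`). As also `aⁿ = bⁿ = 1`, both
scalars are `1` when `3 ∤ n`.

If `3 ∣ n`, central elements are supported in `x`- and `y`-degrees divisible by `n`
(`dvd_of_mem_center`), hence by `3`, so all scalings by cube roots of unity fix the center
(`range_diagAut`). The power `q ^ (n / 3)` supplies a primitive cube root. -/

/-- The group algebra of `G` over `k` with multiplication twisted by a bicharacter `c`. -/
def TwistedAlgebra {k G : Type*} [Field k] [AddCommGroup G] (_c : G →+ G →+ Additive kˣ) : Type _ :=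
  G →₀ k

/-! ### Twisted group algebras: ring structure, commutation, diagonal scalings. -/

namespace TwistedAlgebra

section
variable {k G : Type*} [Field k] [AddCommGroup G] {c : G →+ G →+ Additive kˣ}

noncomputable instance : AddCommGroup (TwistedAlgebra c) := inferInstanceAs (AddCommGroup (G →₀ k))

noncomputable instance : Module k (TwistedAlgebra c) := inferInstanceAs (Module k (G →₀ k))

/-- The coefficient of an element at a group element, as a linear map. -/
noncomputable def coeff (g : G) : TwistedAlgebra c →ₗ[k] k := Finsupp.lapply (M := k) g

variable (c) in
/-- The homogeneous element `a · g`, as a linear map in `a`. -/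
noncomputable def mon (g : G) : k →ₗ[k] TwistedAlgebra c := Finsupp.lsingle (M := k) g

variable (c) in
/-- The value of the bicharacter `c`, as an element of the field. -/
def cocycle (g h : G) : k := ((c g h).toMul : kˣ)

lemma cocycle_ne_zero (g h : G) : cocycle c g h ≠ 0 := Units.ne_zero _

lemma cocycle_add_left (g g' h : G) : cocycle c (g + g') h = cocycle c g h * cocycle c g' h := by
  simp [cocycle]

lemma cocycle_add_right (g h h' : G) : cocycle c g (h + h') = cocycle c g h * cocycle c g h' := by
  simp [cocycle]

@[simp] lemma cocycle_zero_left (h : G) : cocycle c 0 h = 1 := by simp [cocycle]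

@[simp] lemma cocycle_zero_right (h : G) : cocycle c h 0 = 1 := by simp [cocycle]

@[ext] lemma ext {u v : TwistedAlgebra c} (h : ∀ g, coeff g u = coeff g v) : u = v :=
  Finsupp.ext h

lemma coeff_mon_self (g : G) (a : k) : coeff g (mon c g a) = a := Finsupp.single_eq_same

lemma coeff_mon_ne {g h : G} (hgh : g ≠ h) (a : k) : coeff h (mon c g a) = 0 :=
  Finsupp.single_eq_of_ne' hgh

lemma coeff_mon [DecidableEq G] (g h : G) (a : k) :
    coeff h (mon c g a) = if g = h then a else 0 := by
  split_ifs with hgh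
  · rw [hgh, coeff_mon_self]
  · exact coeff_mon_ne hgh a

lemma hom_ext {M : Type*} [AddCommGroup M] [Module k M] {f f' : TwistedAlgebra c →ₗ[k] M}
    (h : ∀ g, f (mon c g 1) = f' (mon c g 1)) : f = f' :=
  Finsupp.lhom_ext' fun g => LinearMap.ext_ring (h g)

/-- The linear map with prescribed values on homogeneous elements. -/
noncomputable def lift {M : Type*} [AddCommGroup M] [Module k M] (f : G → k →ₗ[k] M) :
    TwistedAlgebra c →ₗ[k] M :=
  Finsupp.lsum (M := k) k f

lemma lift_mon {M : Type*} [AddCommGroup M] [Module k M] (f : G → k →ₗ[k] M) (g : G) (a : k) :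
    lift (c := c) f (mon c g a) = f g a :=
  Finsupp.lsum_single k f g a

/-- The support of an element. -/
noncomputable def supp (u : TwistedAlgebra c) : Finset G := Finsupp.support (M := k) u

lemma mem_supp {u : TwistedAlgebra c} {g : G} : g ∈ supp u ↔ coeff g u ≠ 0 :=
  Finsupp.mem_support_iff

lemma sum_mon (u : TwistedAlgebra c) : ∑ g ∈ supp u, mon c g (coeff g u) = u :=
  Finsupp.sum_single (M := k) u

/-- The twisted multiplication as a bilinear map. -/
noncomputable def mulHom :
    TwistedAlgebra c →ₗ[k] TwistedAlgebra c →ₗ[k] TwistedAlgebra c :=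
  lift fun g => LinearMap.toSpanSingleton k _ (lift fun h => cocycle c g h • mon c (g + h))

noncomputable instance : Mul (TwistedAlgebra c) := ⟨fun u v => mulHom u v⟩

noncomputable instance : One (TwistedAlgebra c) := ⟨mon c 0 1⟩

lemma mul_def (u v : TwistedAlgebra c) : u * v = mulHom u v := rfl

lemma one_def : (1 : TwistedAlgebra c) = mon c 0 1 := rfl

lemma mon_mul_mon (g h : G) (a b : k) :
    mon c g a * mon c h b = mon c (g + h) (a * b * cocycle c g h) := by
  rw [mul_def, mulHom, lift_mon, LinearMap.toSpanSingleton_apply, LinearMap.smul_apply, lift_mon,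
    LinearMap.smul_apply, ← map_smul, ← map_smul]
  congr 1
  simp only [smul_eq_mul]
  ring

lemma induction_mon {p : TwistedAlgebra c → Prop} (u : TwistedAlgebra c) (zero : p 0)
    (add : ∀ u v, p u → p v → p (u + v)) (hmon : ∀ g a, p (mon c g a)) : p u :=
  Finsupp.induction_linear u zero (fun u v => add u v) hmon

/-- Bimultiplicativity of `c` gives the 2-cocycle identity, which is associativity on homogeneous
elements. -/
lemma mulHom_assoc (u v w : TwistedAlgebra c) : u * v * w = u * (v * w) := by
  simp only [mul_def]
  induction u using induction_mon with
  | zero => simp only [map_zero, LinearMap.zero_apply]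
  | add u u' hu hu' => simp only [map_add, LinearMap.add_apply, hu, hu']
  | hmon g a =>
    induction v using induction_mon with
    | zero => simp only [map_zero, LinearMap.zero_apply]
    | add u u' hu hu' => simp only [map_add, LinearMap.add_apply, hu, hu']
    | hmon h b =>
      induction w using induction_mon with
      | zero => simp only [map_zero]
      | add u u' hu hu' => simp only [map_add, hu, hu']
      | hmon l d =>
        simp only [← mul_def, mon_mul_mon, cocycle_add_left, cocycle_add_right, add_assoc]
        congr 1
        ring

noncomputable instance : Ring (TwistedAlgebra c) :=
  { (inferInstance : AddCommGroup (TwistedAlgebra c)) with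
    left_distrib := fun u v w => map_add (mulHom u) v w
    right_distrib := fun u v w => by simp only [mul_def, map_add, LinearMap.add_apply]
    zero_mul := fun u => by simp only [mul_def, map_zero, LinearMap.zero_apply]
    mul_zero := fun u => map_zero (mulHom u)
    mul_assoc := mulHom_assoc
    one_mul := fun u => by
      have key : mulHom (mon c 0 1) = LinearMap.id := hom_ext fun g => by
        rw [← mul_def, mon_mul_mon]; simp
      exact congr($key u)
    mul_one := fun u => by
      have key : mulHom.flip (mon c 0 1) = LinearMap.id := hom_ext fun g => by
        rw [LinearMap.flip_apply, ← mul_def, mon_mul_mon]; simp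
      exact congr($key u) }

noncomputable instance : Algebra k (TwistedAlgebra c) :=
  Algebra.ofModule (fun r u v => by simp only [mul_def, map_smul, LinearMap.smul_apply])
    (fun r u v => by simp only [mul_def, map_smul])

lemma coeff_mon_mul (g h : G) (a : k) (v : TwistedAlgebra c) :
    coeff h (mon c g a * v) = a * cocycle c g (h - g) * coeff (h - g) v := by
  classical
  induction v using induction_mon with
  | zero => simp
  | add u v hu hv => rw [mul_add, map_add, hu, hv, map_add, mul_add]
  | hmon l b =>
    rw [mon_mul_mon]
    by_cases hl : g + l = h
    · subst hl
      rw [coeff_mon_self, add_sub_cancel_left, coeff_mon_self]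
      ring
    · rw [coeff_mon_ne hl, coeff_mon_ne (fun h' => hl (by rw [h']; abel)), mul_zero]

lemma coeff_mul_mon (g h : G) (a : k) (v : TwistedAlgebra c) :
    coeff h (v * mon c g a) = coeff (h - g) v * a * cocycle c (h - g) g := by
  classical
  induction v using induction_mon with
  | zero => simp
  | add u v hu hv => rw [add_mul, map_add, hu, hv, map_add]; ring
  | hmon l b =>
    rw [mon_mul_mon]
    by_cases hl : l + g = h
    · subst hl
      rw [coeff_mon_self, add_sub_cancel_right, coeff_mon_self]
    · rw [coeff_mon_ne hl, coeff_mon_ne (fun h' => hl (by rw [h']; abel)), zero_mul, zero_mul]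

lemma coeff_mul (u v : TwistedAlgebra c) (h : G) :
    coeff h (u * v) = ∑ g ∈ supp u, coeff g u * cocycle c g (h - g) * coeff (h - g) v := by
  conv_lhs => rw [← sum_mon u, Finset.sum_mul, map_sum]
  simp only [coeff_mon_mul]

lemma mon_pow_of_cocycle {g : G} (hg : cocycle c g g = 1) (a : k) (m : ℕ) :
    mon c g a ^ m = mon c (m • g) (a ^ m) := by
  have key (m : ℕ) : cocycle c (m • g) g = 1 := by
    induction m with
    | zero => simp
    | succ m ih => rw [succ_nsmul, cocycle_add_left, ih, hg, mul_one]
  induction m with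
  | zero => simp [one_def]
  | succ m ih => rw [pow_succ, ih, mon_mul_mon, key, ← succ_nsmul, mul_one, pow_succ]

/-- A homogeneous element of bicharacter-symmetric degree is central. -/
lemma mon_comm {g : G} (hg : ∀ h, cocycle c g h = cocycle c h g) (a : k) (u : TwistedAlgebra c) :
    mon c g a * u = u * mon c g a := by
  ext h
  rw [coeff_mon_mul, coeff_mul_mon, hg]
  ring

/-- Multiplication by a homogeneous element shifts degrees injectively, so commutation can be tested
one degree at a time. -/
lemma cocycle_eq_of_comm {u : TwistedAlgebra c} {h : G} (hu : mon c h 1 * u = u * mon c h 1)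
    {g : G} (hg : coeff g u ≠ 0) : cocycle c g h = cocycle c h g := by
  have := congr(coeff (g + h) $hu)
  rw [coeff_mon_mul, coeff_mul_mon, add_sub_cancel_right, one_mul, mul_one, mul_comm] at this
  exact (mul_left_cancel₀ hg this).symm

/-- The diagonal automorphism scaling degree `g` by `χ g`. -/
noncomputable def scale (χ : G →+ Additive kˣ) : TwistedAlgebra c →ₐ[k] TwistedAlgebra c :=
  AlgHom.ofLinearMap (lift fun g => ((χ g).toMul : k) • mon c g)
    (by rw [one_def, lift_mon]; simp)
    (fun u v => by
      induction u using induction_mon with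
      | zero => rw [zero_mul, map_zero, zero_mul]
      | add u u' hu hu' => rw [add_mul, map_add, hu, hu', map_add, add_mul]
      | hmon g a =>
        induction v using induction_mon with
        | zero => rw [mul_zero, map_zero, mul_zero]
        | add u u' hu hu' => rw [mul_add, map_add, hu, hu', map_add, mul_add]
        | hmon h b =>
          simp only [mon_mul_mon, lift_mon, LinearMap.smul_apply, ← map_smul, map_add, toMul_add,
            Units.val_mul, smul_eq_mul]
          congr 1
          ring)

lemma scale_mon (χ : G →+ Additive kˣ) (g : G) (a : k) :
    scale χ (mon c g a) = mon c g ((χ g).toMul * a) := by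
  refine (lift_mon _ g a).trans ?_
  rw [LinearMap.smul_apply, ← map_smul, smul_eq_mul]

lemma coeff_scale (χ : G →+ Additive kˣ) (g : G) (u : TwistedAlgebra c) :
    coeff g (scale χ u) = (χ g).toMul * coeff g u := by
  classical
  induction u using induction_mon with
  | zero => simp
  | add u v hu hv => rw [map_add, map_add, hu, hv, map_add, mul_add]
  | hmon h a =>
    rw [scale_mon, coeff_mon, coeff_mon]
    split_ifs with hgh
    · rw [hgh]
    · rw [mul_zero]

end

/-! ### Leading exponents over an ordered group. -/

section
variable {k G : Type*} [Field k] [AddCommGroup G] {c : G →+ G →+ Additive kˣ}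
  [LinearOrder G]

/-- `u` has leading exponent `g`. -/
def IsLead (u : TwistedAlgebra c) (g : G) : Prop :=
  coeff g u ≠ 0 ∧ ∀ h, g < h → coeff h u = 0

lemma IsLead.unique {u : TwistedAlgebra c} {g h : G} (hg : IsLead u g) (hh : IsLead u h) :
    g = h := by
  rcases lt_trichotomy g h with H | H | H
  · exact absurd (hg.2 _ H) hh.1
  · exact H
  · exact absurd (hh.2 _ H) hg.1

lemma exists_isLead {u : TwistedAlgebra c} (hu : u ≠ 0) : ∃ g, IsLead u g := by
  have hne : (supp u).Nonempty := Finsupp.support_nonempty_iff.2 hu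
  refine ⟨_, mem_supp.1 (Finset.max'_mem _ hne), fun h hh => ?_⟩
  by_contra h0
  exact absurd (Finset.le_max' _ h (mem_supp.2 h0)) (not_le.2 hh)

lemma isLead_mon (g : G) {a : k} (ha : a ≠ 0) : IsLead (mon c g a) g :=
  ⟨by rwa [coeff_mon_self], fun _ hh => coeff_mon_ne hh.ne a⟩

lemma isLead_one : IsLead (1 : TwistedAlgebra c) 0 := isLead_mon 0 one_ne_zero

lemma IsLead.add_of_lt {u v : TwistedAlgebra c} {g : G} (hu : IsLead u g)
    (hv : ∀ h, g ≤ h → coeff h v = 0) : IsLead (u + v) g :=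
  ⟨by rw [map_add, hv g le_rfl, add_zero]; exact hu.1,
    fun h hh => by rw [map_add, hu.2 h hh, hv h hh.le, add_zero]⟩

/-- A family with distinct leading exponents: a nontrivial combination has one of them as its
leading exponent. -/
lemma exists_isLead_linearCombination {ι : Type*} {b : ι → TwistedAlgebra c} {e : ι → G}
    (he : Function.Injective e) (hb : ∀ i, IsLead (b i) (e i)) (f : ι →₀ k) (hf : f ≠ 0) :
    ∃ i, IsLead (Finsupp.linearCombination k b f) (e i) := by
  obtain ⟨i, hi, hmax⟩ := Finset.exists_max_image f.support e (Finsupp.support_nonempty_iff.2 hf)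
  refine ⟨i, ?_⟩
  have hco (h : G) : coeff h (Finsupp.linearCombination k b f)
      = ∑ j ∈ f.support, f j * coeff h (b j) := by
    rw [Finsupp.linearCombination_apply, Finsupp.sum, map_sum]
    simp only [map_smul, smul_eq_mul]
  constructor
  · rw [hco, Finset.sum_eq_single i]
    · exact mul_ne_zero (Finsupp.mem_support_iff.1 hi) (hb i).1
    · intro j hj hji
      rw [(hb j).2 _ (lt_of_le_of_ne (hmax j hj) fun H => hji (he H)), mul_zero]
    · exact fun H => absurd hi H
  · intro h hh
    rw [hco]
    refine Finset.sum_eq_zero fun j hj => ?_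
    rw [(hb j).2 _ (lt_of_le_of_lt (hmax j hj) hh), mul_zero]

variable [IsOrderedAddMonoid G]

/-- Only the pair of leading exponents contributes to the top degree, and the cocycle is a unit, so
the product of leading coefficients survives. -/
lemma IsLead.mul {u v : TwistedAlgebra c} {g h : G} (hu : IsLead u g) (hv : IsLead v h) :
    IsLead (u * v) (g + h) := by
  constructor
  · rw [coeff_mul, Finset.sum_eq_single g]
    · rw [add_sub_cancel_left]
      exact mul_ne_zero (mul_ne_zero hu.1 (cocycle_ne_zero _ _)) hv.1
    · intro l hl hlg
      rcases lt_or_gt_of_ne hlg with H | H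
      · rw [hv.2 (g + h - l), mul_zero]
        rw [lt_sub_iff_add_lt, add_comm]
        gcongr
      · exact absurd (hu.2 l H) (mem_supp.1 hl)
    · intro hg
      exact absurd (mem_supp.2 hu.1) hg
  · intro m hm
    rw [coeff_mul]
    refine Finset.sum_eq_zero fun l hl => ?_
    have hlg : l ≤ g := not_lt.1 fun H => mem_supp.1 hl (hu.2 l H)
    rw [hv.2 (m - l), mul_zero]
    rw [lt_sub_iff_add_lt, add_comm]
    exact lt_of_le_of_lt (by gcongr) hm

lemma IsLead.pow {u : TwistedAlgebra c} {g : G} (hu : IsLead u g) (m : ℕ) :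
    IsLead (u ^ m) (m • g) := by
  induction m with
  | zero => rw [pow_zero, zero_smul]; exact isLead_one
  | succ m ih => rw [pow_succ, succ_nsmul]; exact ih.mul hu

lemma isLead_of_pow_eq_mon {u : TwistedAlgebra c} {m : ℕ} (hm : m ≠ 0) {g : G} {a : k}
    (ha : a ≠ 0) (h : u ^ m = mon c (m • g) a) : IsLead u g := by
  have hu : u ≠ 0 := by
    rintro rfl
    rw [zero_pow hm] at h
    apply ha
    rw [← coeff_mon_self (c := c) (m • g) a, ← h, map_zero]
  obtain ⟨g', hg'⟩ := exists_isLead hu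
  have h1 := hg'.pow m
  rw [h] at h1
  have h2 := h1.unique (isLead_mon _ ha)
  rwa [← nsmul_right_injective hm h2]

end

section
variable {k G : Type*} [Field k] [AddCommGroup G] {c : G →+ G →+ Additive kˣ}

/-- Over an orderable group, a root of a homogeneous element is homogeneous. -/
lemma eq_mon_of_pow_eq_mon [L : LinearOrder G] [IsOrderedAddMonoid G] {u : TwistedAlgebra c}
    {m : ℕ} (hm : m ≠ 0) {g : G} {a : k} (ha : a ≠ 0) (h : u ^ m = mon c (m • g) a) :
    u = mon c g (coeff g u) := by
  have top := isLead_of_pow_eq_mon hm ha h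
  -- Reversing the order of `G` turns the bound on the leading exponent into one on the trailing
  -- exponent.
  have bot : ∀ h < g, coeff h u = 0 :=
    (@isLead_of_pow_eq_mon k G _ _ c (inferInstanceAs (LinearOrder Gᵒᵈ))
      (inferInstanceAs (IsOrderedAddMonoid Gᵒᵈ)) u m hm g a ha h).2
  ext l
  rcases lt_trichotomy l g with H | H | H
  · rw [bot l H, coeff_mon_ne H.ne']
  · rw [H, coeff_mon_self]
  · rw [top.2 l H, coeff_mon_ne H.ne]

end

end TwistedAlgebra

/-! ### The exponent group and the quantum torus. -/

namespace AlgB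

/-- Exponents `(l, i, j)`, ordered lexicographically. -/
abbrev Exponent : Type := ℤ ×ₗ ℤ ×ₗ ℤ

namespace Exponent

/-- The exponent `(l, i, j)`. -/
def mk (l i j : ℤ) : Exponent := toLex (l, toLex (i, j))

/-- The exponent of `x`. -/
def xdeg : Exponent →+ ℤ where
  toFun g := (ofLex (ofLex g).2).1
  map_zero' := rfl
  map_add' _ _ := rfl

/-- The exponent of `y`. -/
def ydeg : Exponent →+ ℤ where
  toFun g := (ofLex (ofLex g).2).2
  map_zero' := rfl
  map_add' _ _ := rfl

@[simp] lemma xdeg_mk (l i j : ℤ) : xdeg (mk l i j) = i := rfl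

@[simp] lemma ydeg_mk (l i j : ℤ) : ydeg (mk l i j) = j := rfl

lemma mk_add_mk (l i j l' i' j' : ℤ) :
    mk l i j + mk l' i' j' = mk (l + l') (i + i') (j + j') := rfl

lemma nsmul_mk (m : ℕ) (l i j : ℤ) : m • mk l i j = mk (m * l) (m * i) (m * j) := by
  induction m with
  | zero => simp [mk]; rfl
  | succ m ih =>
    rw [succ_nsmul, ih, mk_add_mk]
    push_cast
    simp only [add_mul, one_mul]

lemma mk_inj {l i j l' i' j' : ℤ} : mk l i j = mk l' i' j' ↔ l = l' ∧ i = i' ∧ j = j' := by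
  simp [mk]

lemma mk_lt_mk {l i j l' i' j' : ℤ} (h : l < l') : mk l i j < mk l' i' j' :=
  Prod.Lex.toLex_lt_toLex.2 (Or.inl h)

end Exponent

open Exponent TwistedAlgebra

section
variable {k : Type*} [Field k]

/-- The bicharacter `(g, h) ↦ q ^ (-(ydeg g * xdeg h))` of the quantum torus. -/
def bichar (q : kˣ) : Exponent →+ Exponent →+ Additive kˣ :=
  AddMonoidHom.mk' (fun g => AddMonoidHom.mk'
    (fun h => Additive.ofMul (q ^ (-(ydeg g * xdeg h))))
    (fun h h' => by rw [← ofMul_mul, ← zpow_add, map_add, mul_add, neg_add]))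
    (fun g g' => by
      ext h
      simp only [AddMonoidHom.mk'_apply, AddMonoidHom.add_apply]
      rw [← ofMul_mul, ← zpow_add, map_add, add_mul, neg_add])

lemma cocycle_bichar (q : kˣ) (g h : Exponent) :
    cocycle (bichar q) g h = (q : k) ^ (-(ydeg g * xdeg h)) := by
  simp [cocycle, bichar]

/-- The quantum torus in `x, y` with a central polynomial variable adjoined and inverted. -/
abbrev Torus (q : kˣ) := TwistedAlgebra (bichar q)

/-! ### Presentation of `B_q` and its spanning monomials. -/

section generators
variable (q : k)

/-- The generator `x` of `B_q`. -/
def gx : AlgB q := RingQuot.mkAlgHom k (Rel q) (X k)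

/-- The generator `y` of `B_q`. -/
def gy : AlgB q := RingQuot.mkAlgHom k (Rel q) (Y k)

/-- The generator `z` of `B_q`. -/
def gz : AlgB q := RingQuot.mkAlgHom k (Rel q) (Z k)

lemma gx_mul_gy : gx q * gy q = q • (gy q * gx q) := by
  simpa [gx, gy] using RingQuot.mkAlgHom_rel k (Rel.xy (q := q))

lemma gz_mul_gx : gz q * gx q = q • (gx q * gz q) + gy q ^ 2 := by
  simpa [gx, gy, gz] using RingQuot.mkAlgHom_rel k (Rel.zx (q := q))

lemma gz_mul_gy : gz q * gy q = q⁻¹ • (gy q * gz q) + gx q ^ 2 := by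
  simpa [gx, gy, gz] using RingQuot.mkAlgHom_rel k (Rel.zy (q := q))

variable {q} in
/-- An algebra homomorphism out of `B_q` from elements satisfying its relations. -/
def liftHom {A : Type*} [Ring A] [Algebra k A] (x y z : A) (hxy : x * y = q • (y * x))
    (hzx : z * x = q • (x * z) + y ^ 2) (hzy : z * y = q⁻¹ • (y * z) + x ^ 2) :
    AlgB q →ₐ[k] A :=
  RingQuot.liftAlgHom k ⟨FreeAlgebra.lift k ![x, y, z], by
    rintro _ _ (_ | _ | _)
    · simpa [X, Y, Z] using hxy
    · simpa [X, Y, Z] using hzx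
    · simpa [X, Y, Z] using hzy⟩

variable {q} in
lemma liftHom_gens {A : Type*} [Ring A] [Algebra k A] {x y z : A} (hxy : x * y = q • (y * x))
    (hzx : z * x = q • (x * z) + y ^ 2) (hzy : z * y = q⁻¹ • (y * z) + x ^ 2) :
    liftHom x y z hxy hzx hzy (gx q) = x ∧ liftHom x y z hxy hzx hzy (gy q) = y ∧
      liftHom x y z hxy hzx hzy (gz q) = z := by
  simp [liftHom, gx, gy, gz, X, Y, Z]

variable {q} in
lemma algHom_ext {A : Type*} [Ring A] [Algebra k A] {f g : AlgB q →ₐ[k] A}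
    (hx : f (gx q) = g (gx q)) (hy : f (gy q) = g (gy q)) (hz : f (gz q) = g (gz q)) : f = g := by
  refine RingQuot.ringQuot_ext' k _ _ (FreeAlgebra.hom_ext (funext fun i => ?_))
  fin_cases i
  · exact hx
  · exact hy
  · exact hz

variable {q} (hq0 : q ≠ 0)
include hq0

lemma gy_mul_gx : gy q * gx q = q⁻¹ • (gx q * gy q) := by
  rw [gx_mul_gy, smul_smul, inv_mul_cancel₀ hq0, one_smul]

lemma gy_mul_gx_pow (i : ℕ) : gy q * gx q ^ i = (q⁻¹) ^ i • (gx q ^ i * gy q) := by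
  induction i with
  | zero => simp
  | succ i ih =>
    rw [pow_succ, ← mul_assoc, ih, smul_mul_assoc, mul_assoc, gy_mul_gx hq0, mul_smul_comm,
      smul_smul, ← mul_assoc, pow_succ]

lemma gy_pow_mul_gx (j : ℕ) : gy q ^ j * gx q = (q⁻¹) ^ j • (gx q * gy q ^ j) := by
  induction j with
  | zero => simp
  | succ j ih =>
    rw [pow_succ', mul_assoc, ih, mul_smul_comm, ← mul_assoc, gy_mul_gx hq0, smul_mul_assoc,
      smul_smul, mul_assoc, pow_succ]

/-- Only the shape of the reordered product matters for spanning, so the scalars stay implicit.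
Truncated `i - 1` is harmless at `i = 0`, where `b = 0`. -/
lemma exists_gz_mul_gx_pow (i : ℕ) : ∃ a b : k,
    gz q * gx q ^ i = a • (gx q ^ i * gz q) + b • (gx q ^ (i - 1) * gy q ^ 2) := by
  induction i with
  | zero => exact ⟨1, 0, by simp⟩
  | succ i ih =>
    obtain ⟨a, b, h⟩ := ih
    rcases i with _ | i
    · exact ⟨q, 1, by simp [gz_mul_gx]⟩
    · refine ⟨a * q, a + b * (q⁻¹) ^ 2, ?_⟩
      rw [pow_succ, ← mul_assoc, h, add_mul, smul_mul_assoc, smul_mul_assoc, mul_assoc,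
        gz_mul_gx, mul_assoc _ _ (gx q), gy_pow_mul_gx hq0, mul_add, mul_smul_comm, mul_smul_comm,
        smul_add, smul_smul, smul_smul, add_smul, ← mul_assoc, ← mul_assoc]
      simp only [Nat.add_sub_cancel, ← pow_succ]
      abel

lemma exists_gz_mul_gy_pow (j : ℕ) : ∃ a b : k,
    gz q * gy q ^ j = a • (gy q ^ j * gz q) + b • (gx q ^ 2 * gy q ^ (j - 1)) := by
  induction j with
  | zero => exact ⟨1, 0, by simp⟩
  | succ j ih =>
    obtain ⟨a, b, h⟩ := ih
    rcases j with _ | j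
    · exact ⟨q⁻¹, 1, by simp [gz_mul_gy]⟩
    · have h2 : gy q ^ (j + 1) * gx q ^ 2
          = ((q⁻¹) ^ (j + 1) * (q⁻¹) ^ (j + 1)) • (gx q ^ 2 * gy q ^ (j + 1)) := by
        rw [pow_two, ← mul_assoc, gy_pow_mul_gx hq0, smul_mul_assoc, mul_assoc,
          gy_pow_mul_gx hq0, mul_smul_comm, smul_smul, mul_assoc]
      refine ⟨a * q⁻¹, a * ((q⁻¹) ^ (j + 1) * (q⁻¹) ^ (j + 1)) + b, ?_⟩
      rw [pow_succ _ (j + 1), ← mul_assoc, h, add_mul, smul_mul_assoc, smul_mul_assoc,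
        mul_assoc (gy q ^ (j + 1)), gz_mul_gy, mul_add, h2, mul_smul_comm, smul_add, smul_smul,
        smul_smul, add_smul, mul_assoc (gx q ^ 2), ← pow_succ, Nat.add_sub_cancel,
        Nat.add_sub_cancel, ← mul_assoc (gy q ^ (j + 1)), ← pow_succ, add_assoc]

/-- The ordered monomials `x ^ i * y ^ j * z ^ l` span `B_q`. -/
lemma span_monomials :
    Submodule.span k (Set.range fun m : ℕ × ℕ × ℕ => gx q ^ m.1 * gy q ^ m.2.1 * gz q ^ m.2.2)
      = ⊤ := by
  set S := Submodule.span k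
    (Set.range fun m : ℕ × ℕ × ℕ => gx q ^ m.1 * gy q ^ m.2.1 * gz q ^ m.2.2) with hS
  have mem (i j l : ℕ) : gx q ^ i * gy q ^ j * gz q ^ l ∈ S :=
    Submodule.subset_span ⟨(i, j, l), rfl⟩
  have closed (w : AlgB q) (hw : ∀ i j l, w * (gx q ^ i * gy q ^ j * gz q ^ l) ∈ S) :
      ∀ u ∈ S, w * u ∈ S := by
    intro u hu
    induction hu using Submodule.span_induction with
    | mem u hu => obtain ⟨m, rfl⟩ := hu; exact hw _ _ _
    | zero => rw [mul_zero]; exact S.zero_mem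
    | add u v _ _ hu hv => rw [mul_add]; exact S.add_mem hu hv
    | smul a u _ hu => rw [mul_smul_comm]; exact S.smul_mem _ hu
  have hx : ∀ u ∈ S, gx q * u ∈ S := closed _ fun i j l => by
    rw [← mul_assoc, ← mul_assoc, ← pow_succ']
    exact mem _ _ _
  have hxp (i : ℕ) : ∀ u ∈ S, gx q ^ i * u ∈ S := by
    induction i with
    | zero => simp
    | succ i ih => intro u hu; rw [pow_succ', mul_assoc]; exact hx _ (ih u hu)
  have hy : ∀ u ∈ S, gy q * u ∈ S := closed _ fun i j l => by
    rw [← mul_assoc, ← mul_assoc, gy_mul_gx_pow hq0, smul_mul_assoc, smul_mul_assoc,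
      mul_assoc (gx q ^ i), ← pow_succ']
    exact S.smul_mem _ (mem _ _ _)
  have hz : ∀ u ∈ S, gz q * u ∈ S := closed _ fun i j l => by
    obtain ⟨a, b, h⟩ := exists_gz_mul_gx_pow hq0 i
    obtain ⟨a', b', h'⟩ := exists_gz_mul_gy_pow hq0 j
    have e1 : gz q * (gx q ^ i * gy q ^ j * gz q ^ l)
        = a • (gx q ^ i * (gz q * gy q ^ j * gz q ^ l))
          + b • (gx q ^ (i - 1) * gy q ^ (2 + j) * gz q ^ l) := by
      rw [← mul_assoc, ← mul_assoc, h, pow_add]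
      simp only [add_mul, smul_mul_assoc, mul_assoc]
    have e2 : gz q * gy q ^ j * gz q ^ l
        = a' • (gx q ^ 0 * gy q ^ j * gz q ^ (l + 1))
          + b' • (gx q ^ 2 * gy q ^ (j - 1) * gz q ^ l) := by
      rw [h', pow_succ' _ l]
      simp only [add_mul, smul_mul_assoc, mul_assoc, pow_zero, one_mul]
    rw [e1, e2]
    exact S.add_mem (S.smul_mem _ (hxp _ _ (S.add_mem (S.smul_mem _ (mem _ _ _))
      (S.smul_mem _ (mem _ _ _))))) (S.smul_mem _ (mem _ _ _))
  -- The span is a left ideal; as it contains `1`, it is everything.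
  have main (f : FreeAlgebra k (Fin 3)) : ∀ u ∈ S, RingQuot.mkAlgHom k (Rel q) f * u ∈ S := by
    induction f using FreeAlgebra.induction with
    | grade0 r =>
      intro u hu
      rw [AlgHom.commutes, ← Algebra.smul_def]
      exact S.smul_mem _ hu
    | grade1 i =>
      fin_cases i
      · exact hx
      · exact hy
      · exact hz
    | mul a b ha hb =>
      intro u hu
      rw [map_mul, mul_assoc]
      exact ha _ (hb _ hu)
    | add a b ha hb =>
      intro u hu
      rw [map_add, add_mul]
      exact S.add_mem (ha _ hu) (hb _ hu)
  rw [eq_top_iff]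
  rintro u -
  obtain ⟨f, rfl⟩ := RingQuot.mkAlgHom_surjective k (Rel q) u
  have h1 : (1 : AlgB q) ∈ S := by simpa using mem 0 0 0
  simpa using main f 1 h1

end generators

/-! ### The embedding into the torus, central elements, and rigidity of ozone automorphisms. -/

section embedding
variable (q : kˣ)

/-- The coefficient of `x ^ 2 * y⁻¹` in the image of `z` in the torus. -/
def zcoeffX : k := (1 - (q : k)⁻¹ ^ 3)⁻¹

/-- The coefficient of `x⁻¹ * y ^ 2` in the image of `z` in the torus. -/
def zcoeffY : k := ((q : k)⁻¹ ^ 2 - q)⁻¹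

/-- The image of `x` in the torus. -/
noncomputable def tx : Torus q := mon _ (mk 0 1 0) 1

/-- The image of `y` in the torus. -/
noncomputable def ty : Torus q := mon _ (mk 0 0 1) 1

/-- The image of `z` in the torus. -/
noncomputable def tz : Torus q :=
  mon _ (mk 1 (-1) (-1)) 1 + (mon _ (mk 0 2 (-1)) (zcoeffX q) + mon _ (mk 0 (-1) 2) (zcoeffY q))

variable {q}

lemma mon_mul (l i j l' i' j' : ℤ) (a b : k) :
    mon (bichar q) (mk l i j) a * mon _ (mk l' i' j') b
      = mon _ (mk (l + l') (i + i') (j + j')) (a * b * (q : k) ^ (-(j * i'))) := by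
  rw [mon_mul_mon, cocycle_bichar, mk_add_mk, xdeg_mk, ydeg_mk]

lemma zcoeffX_mul (hq : (q : k) ^ 3 ≠ 1) : zcoeffX q * (1 - (q : k)⁻¹ ^ 3) = 1 := by
  refine inv_mul_cancel₀ fun h => hq ?_
  have := q.ne_zero
  field_simp at h
  linear_combination h

lemma zcoeffY_mul (hq : (q : k) ^ 3 ≠ 1) : zcoeffY q * ((q : k)⁻¹ ^ 2 - q) = 1 := by
  refine inv_mul_cancel₀ fun h => hq ?_
  have := q.ne_zero
  field_simp at h
  linear_combination -h

lemma zcoeffX_ne_zero (hq : (q : k) ^ 3 ≠ 1) : zcoeffX q ≠ 0 :=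
  left_ne_zero_of_mul_eq_one (zcoeffX_mul hq)

lemma zcoeffY_ne_zero (hq : (q : k) ^ 3 ≠ 1) : zcoeffY q ≠ 0 :=
  left_ne_zero_of_mul_eq_one (zcoeffY_mul hq)

lemma tx_mul_ty : tx q * ty q = (q : k) • (ty q * tx q) := by
  simp [tx, ty, mon_mul, ← map_smul]

/-- In `zx - q xz` the first two terms of `tz` cancel and `x⁻¹y²` leaves `(q⁻² - q) y²`, which
`zcoeffY` normalizes. In `zy - q⁻¹ yz` only `x²y⁻¹` survives, with factor `1 - q⁻³`. -/
lemma tz_mul_tx (hq : (q : k) ^ 3 ≠ 1) : tz q * tx q = (q : k) • (tx q * tz q) + ty q ^ 2 := by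
  simp only [tz, tx, ty, pow_two, add_mul, mul_add, mon_mul, smul_add, ← map_smul]
  norm_num [add_assoc]
  rw [← map_add, mul_comm]
  congr 2
  linear_combination (norm := ring_nf) zcoeffY_mul hq

lemma tz_mul_ty (hq : (q : k) ^ 3 ≠ 1) : tz q * ty q = (q : k)⁻¹ • (ty q * tz q) + tx q ^ 2 := by
  have := q.ne_zero
  simp only [tz, tx, ty, pow_two, add_mul, mul_add, mon_mul, smul_add, ← map_smul]
  norm_num [add_assoc]
  rw [add_comm (mon _ (mk 0 (-1) 3) _), ← add_assoc, ← map_add, mul_comm (zcoeffY q),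
    inv_mul_cancel_left₀ this]
  congr 2
  linear_combination (norm := ring_nf) zcoeffX_mul hq

/-- The embedding of `B_q` into the torus. -/
noncomputable def embed (hq : (q : k) ^ 3 ≠ 1) : AlgB (q : k) →ₐ[k] Torus q :=
  liftHom (tx q) (ty q) (tz q) tx_mul_ty (tz_mul_tx hq) (tz_mul_ty hq)

lemma embed_gx (hq : (q : k) ^ 3 ≠ 1) : embed hq (gx _) = mon _ (mk 0 1 0) 1 :=
  (liftHom_gens _ _ _).1

lemma embed_gy (hq : (q : k) ^ 3 ≠ 1) : embed hq (gy _) = mon _ (mk 0 0 1) 1 :=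
  (liftHom_gens _ _ _).2.1

lemma embed_gz (hq : (q : k) ^ 3 ≠ 1) : embed hq (gz _) = tz q :=
  (liftHom_gens _ _ _).2.2

lemma isLead_tz : IsLead (tz q) (mk 1 (-1) (-1)) := by
  refine (isLead_mon _ one_ne_zero).add_of_lt fun h hh => ?_
  rw [map_add, coeff_mon_ne, coeff_mon_ne, add_zero]
  · exact ((mk_lt_mk zero_lt_one).trans_le hh).ne
  · exact ((mk_lt_mk zero_lt_one).trans_le hh).ne

/-- The leading exponents of images of nonzero elements of `B_q`. -/
lemma exists_isLead_embed (hq : (q : k) ^ 3 ≠ 1) {b : AlgB (q : k)} (hb : b ≠ 0) :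
    ∃ i j l : ℕ, IsLead (embed hq b) (mk l (i - l) (j - l)) := by
  have hmem : b ∈ Submodule.span k (Set.range fun m : ℕ × ℕ × ℕ =>
      gx (q : k) ^ m.1 * gy (q : k) ^ m.2.1 * gz (q : k) ^ m.2.2) := by
    rw [span_monomials q.ne_zero]; trivial
  obtain ⟨f, rfl⟩ := Finsupp.mem_span_range_iff_exists_finsupp.1 hmem
  have hf : f ≠ 0 := by rintro rfl; exact hb Finsupp.sum_zero_index
  -- Since `z` leads with `t x⁻¹y⁻¹`, the monomial `x^i y^j z^l` leads with exponent `(l, i - l, j -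
  -- l)`, which determines it.
  have hinj : Function.Injective fun m : ℕ × ℕ × ℕ =>
      mk m.2.2 (m.1 - m.2.2) (m.2.1 - m.2.2) := by
    rintro ⟨i, j, l⟩ ⟨i', j', l'⟩ h
    have := mk_inj.1 h
    simp only at this
    obtain ⟨rfl, rfl, rfl⟩ : i = i' ∧ j = j' ∧ l = l' := by omega
    rfl
  obtain ⟨m, hm⟩ := exists_isLead_linearCombination hinj (b := fun m : ℕ × ℕ × ℕ =>
      embed hq (gx (q : k) ^ m.1 * gy (q : k) ^ m.2.1 * gz (q : k) ^ m.2.2)) (fun m => by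
    have hx := (isLead_mon (c := bichar q) (mk 0 1 0) (one_ne_zero (α := k))).pow m.1
    have hy := (isLead_mon (c := bichar q) (mk 0 0 1) (one_ne_zero (α := k))).pow m.2.1
    have := (hx.mul hy).mul ((isLead_tz (q := q)).pow m.2.2)
    rw [map_mul, map_mul, map_pow, map_pow, map_pow, embed_gx, embed_gy, embed_gz]
    convert this using 1
    simp only [nsmul_mk, mk_add_mk, mk_inj]
    refine ⟨?_, ?_, ?_⟩ <;> ring) f hf
  refine ⟨m.1, m.2.1, m.2.2, ?_⟩
  convert hm using 1
  rw [Finsupp.linearCombination_apply, Finsupp.sum, Finsupp.sum, map_sum]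
  simp only [map_smul]

lemma embed_injective (hq : (q : k) ^ 3 ≠ 1) : Function.Injective (embed hq) := by
  refine (injective_iff_map_eq_zero _).2 fun b hb => ?_
  by_contra h0
  obtain ⟨i, j, l, h⟩ := exists_isLead_embed hq h0
  exact h.1 (by rw [hb, map_zero])

lemma mem_center_of_embed (hq : (q : k) ^ 3 ≠ 1) {b : AlgB (q : k)} {g : Exponent} {a : k}
    (hb : embed hq b = mon _ g a)
    (hg : ∀ h, cocycle (bichar q) g h = cocycle (bichar q) h g) :
    b ∈ Subalgebra.center k (AlgB (q : k)) :=
  Subalgebra.mem_center_iff.2 fun u => embed_injective hq (by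
    rw [map_mul, map_mul, hb, mon_comm hg])

lemma embed_gx_pow (hq : (q : k) ^ 3 ≠ 1) (m : ℕ) :
    embed hq (gx _ ^ m) = mon _ (mk 0 m 0) 1 := by
  rw [map_pow, embed_gx, mon_pow_of_cocycle (by simp [cocycle_bichar]), nsmul_mk]
  simp

lemma embed_gy_pow (hq : (q : k) ^ 3 ≠ 1) (m : ℕ) :
    embed hq (gy _ ^ m) = mon _ (mk 0 0 m) 1 := by
  rw [map_pow, embed_gy, mon_pow_of_cocycle (by simp [cocycle_bichar]), nsmul_mk]
  simp

lemma gx_pow_mem_center (hq : (q : k) ^ 3 ≠ 1) {n : ℕ} (hn : (q : k) ^ n = 1) :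
    gx (q : k) ^ n ∈ Subalgebra.center k (AlgB (q : k)) :=
  mem_center_of_embed hq (embed_gx_pow hq n) fun h => by
    simp [cocycle_bichar, mul_comm, zpow_mul, hn]

lemma gy_pow_mem_center (hq : (q : k) ^ 3 ≠ 1) {n : ℕ} (hn : (q : k) ^ n = 1) :
    gy (q : k) ^ n ∈ Subalgebra.center k (AlgB (q : k)) :=
  mem_center_of_embed hq (embed_gy_pow hq n) fun h => by
    simp [cocycle_bichar, zpow_mul, hn]

/-- The cubic central element of `B_q`. -/
def cubic (q : kˣ) : AlgB (q : k) :=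
  gx _ * gy _ * gz _ - (zcoeffX q * (q : k)⁻¹ ^ 2) • gx _ ^ 3 - (zcoeffY q * q) • gy _ ^ 3

/-- The last two terms are exactly what `cubic` subtracts; the powers of `q` come from moving `y`
past `x²` and `x⁻¹`. -/
lemma mon_mul_tz : mon (bichar q) (mk 0 1 1) 1 * tz q = mon _ (mk 1 0 0) (q : k)
    + (mon _ (mk 0 3 0) (zcoeffX q * (q : k)⁻¹ ^ 2) + mon _ (mk 0 0 3) (zcoeffY q * q)) := by
  simp only [tz, mul_add, mon_mul]
  norm_num

lemma embed_gx_mul_gy (hq : (q : k) ^ 3 ≠ 1) :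
    embed hq (gx _ * gy _) = mon _ (mk 0 1 1) 1 := by
  rw [map_mul, embed_gx, embed_gy, mon_mul]
  simp

lemma embed_cubic (hq : (q : k) ^ 3 ≠ 1) : embed hq (cubic q) = mon _ (mk 1 0 0) (q : k) := by
  rw [cubic, map_sub, map_sub, map_mul, embed_gx_mul_gy, embed_gz, mon_mul_tz, map_smul, map_smul,
    embed_gx_pow, embed_gy_pow, ← map_smul, ← map_smul, smul_eq_mul, smul_eq_mul, mul_one, mul_one]
  push_cast
  abel

lemma cubic_mem_center (hq : (q : k) ^ 3 ≠ 1) :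
    cubic q ∈ Subalgebra.center k (AlgB (q : k)) :=
  mem_center_of_embed hq (embed_cubic hq) fun h => by simp [cocycle_bichar]

/-- The image of `u` is an `n`-th root of a homogeneous element, hence homogeneous of the degree of
`v`. -/
lemma eq_smul_of_pow_eq (hq : (q : k) ^ 3 ≠ 1) {u v : AlgB (q : k)} {n : ℕ} (hn : n ≠ 0)
    {g : Exponent} (hv : embed hq v = mon _ g 1) (hg : cocycle (bichar q) g g = 1)
    (h : u ^ n = v ^ n) : ∃ a : k, u = a • v ∧ a ^ n = 1 := by
  have hvn : embed hq v ^ n = mon _ (n • g) 1 := by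
    rw [hv, mon_pow_of_cocycle hg, one_pow]
  have hu := eq_mon_of_pow_eq_mon hn one_ne_zero (u := embed hq u)
    (by rw [← map_pow, h, map_pow, hvn])
  have huv : u = coeff g (embed hq u) • v := embed_injective hq (by
    rw [map_smul, hv, ← map_smul, smul_eq_mul, mul_one]
    exact hu)
  refine ⟨_, huv, ?_⟩
  have := congr(coeff (n • g) (embed hq $h))
  rw [huv, smul_pow, map_smul, map_pow, hvn, map_smul, coeff_mon_self, smul_eq_mul,
    mul_one] at this
  exact this

/-- The automorphisms in the ozone group of `B_q` are diagonal. -/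
lemma exists_of_mem_ozoneGroup (hq : (q : k) ^ 3 ≠ 1) {n : ℕ} (hn0 : n ≠ 0)
    (hn : (q : k) ^ n = 1) {σ : AlgB (q : k) ≃ₐ[k] AlgB (q : k)}
    (hσ : σ ∈ ozoneGroup k (AlgB (q : k))) :
    ∃ a b : k, a ^ n = 1 ∧ b ^ n = 1 ∧ a ^ 3 = 1 ∧ b ^ 3 = 1 ∧ σ (gx _) = a • gx _ ∧
      σ (gy _) = b • gy _ ∧ (a * b) • σ (gz _) = gz _ := by
  obtain ⟨a, hx, ha⟩ := eq_smul_of_pow_eq hq hn0 (u := σ (gx _)) (embed_gx hq)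
    (by simp [cocycle_bichar]) (by rw [← map_pow]; exact hσ _ (gx_pow_mem_center hq hn))
  obtain ⟨b, hy, hb⟩ := eq_smul_of_pow_eq hq hn0 (u := σ (gy _)) (embed_gy hq)
    (by simp [cocycle_bichar]) (by rw [← map_pow]; exact hσ _ (gy_pow_mem_center hq hn))
  -- `w` is the defect of `σ` on `z`; invariance of `cubic` expresses `xyw` through `x³` and `y³`
  -- alone.
  set w := (a * b) • σ (gz _) - gz _ with hw
  have hcubic : σ (cubic q) = cubic q := hσ _ (cubic_mem_center hq)
  have key : mon (bichar q) (mk 0 1 1) 1 * embed hq w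
      = mon _ (mk 0 3 0) (zcoeffX q * (q : k)⁻¹ ^ 2 * (a ^ 3 - 1))
        + mon _ (mk 0 0 3) (zcoeffY q * q * (b ^ 3 - 1)) := by
    have h1 : gx _ * gy _ * w = (zcoeffX q * (q : k)⁻¹ ^ 2 * (a ^ 3 - 1)) • gx _ ^ 3
        + (zcoeffY q * q * (b ^ 3 - 1)) • gy _ ^ 3 := by
      rw [cubic, map_sub, map_sub, map_smul, map_smul, map_pow, map_pow, map_mul, map_mul, hx, hy,
        smul_pow, smul_pow, smul_mul_smul_comm, smul_mul_assoc, sub_sub, sub_sub,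
        sub_eq_sub_iff_sub_eq_sub] at hcubic
      rw [hw, mul_sub, mul_smul_comm, hcubic]
      module
    have h2 := congr(embed hq $h1)
    rw [map_mul, embed_gx_mul_gy, map_add, map_smul, map_smul, embed_gx_pow, embed_gy_pow,
      ← map_smul, ← map_smul, smul_eq_mul, smul_eq_mul, mul_one, mul_one] at h2
    exact h2
  -- If `w ≠ 0`, then `xyw` leads with `(l, i + 1 - l, j + 1 - l)`. For `l = 0` both other entries
  -- are positive, so this is never the exponent of `x³` or `y³`.
  have hw0 : w = 0 := by
    by_contra hne
    obtain ⟨i, j, l, hl⟩ := exists_isLead_embed hq hne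
    have := ((isLead_mon (c := bichar q) (mk 0 1 1) (one_ne_zero (α := k))).mul hl).1
    rw [key, mk_add_mk, map_add] at this
    refine this ?_
    rw [coeff_mon_ne, coeff_mon_ne, add_zero] <;> rw [Ne, mk_inj] <;> omega
  rw [hw0, map_zero, mul_zero] at key
  have e1 := congr(coeff (mk 0 3 0) $key)
  have e2 := congr(coeff (mk 0 0 3) $key)
  rw [map_zero, map_add, coeff_mon_self, coeff_mon_ne (by simp [mk_inj]), add_zero] at e1
  rw [map_zero, map_add, coeff_mon_self, coeff_mon_ne (by simp [mk_inj]), zero_add] at e2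
  have hq0 := q.ne_zero
  have hX := zcoeffX_ne_zero hq
  have hY := zcoeffY_ne_zero hq
  refine ⟨a, b, ha, hb, ?_, ?_, hx, hy, sub_eq_zero.1 hw0⟩
  · simpa [hq0, hX, sub_eq_zero] using e1.symm
  · simpa [hq0, hY, sub_eq_zero] using e2.symm

lemma algEquiv_ext {q : k} {σ τ : AlgB q ≃ₐ[k] AlgB q} (hx : σ (gx q) = τ (gx q))
    (hy : σ (gy q) = τ (gy q)) (hz : σ (gz q) = τ (gz q)) : σ = τ :=
  AlgEquiv.ext fun u => DFunLike.congr_fun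
    (algHom_ext (f := σ.toAlgHom) (g := τ.toAlgHom) hx hy hz) u

/-- The ozone group of `B_q` is trivial if the order of `q` is prime to `3`. -/
lemma ozoneGroup_eq_bot (hq : (q : k) ^ 3 ≠ 1) {n : ℕ} (hn0 : n ≠ 0)
    (hn : (q : k) ^ n = 1) (h3 : ¬ 3 ∣ n) : ozoneGroup k (AlgB (q : k)) = ⊥ := by
  refine (Subgroup.eq_bot_iff_forall _).2 fun σ hσ => ?_
  obtain ⟨a, b, ha, hb, ha3, hb3, hx, hy, hz⟩ := exists_of_mem_ozoneGroup hq hn0 hn hσ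
  -- The order of `a` divides both `3` and `n`, so it is `1`.
  have hone (a : k) (ha : a ^ n = 1) (ha3 : a ^ 3 = 1) : a = 1 := by
    have := orderOf_dvd_of_pow_eq_one ha
    have h' := orderOf_dvd_of_pow_eq_one ha3
    rcases (Nat.dvd_prime Nat.prime_three).1 h' with h | h
    · exact orderOf_eq_one_iff.1 h
    · exact absurd (h ▸ this) h3
  rw [hone a ha ha3] at hx hz
  rw [hone b hb hb3] at hy hz
  exact algEquiv_ext (by simpa using hx) (by simpa using hy) (by simpa using hz)

end embedding

/-! ### Diagonal automorphisms from cube roots of unity. -/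

section diagonal

lemma rootsOfUnity_pow_three (a : rootsOfUnity 3 k) : ((a : kˣ) : k) ^ 3 = 1 :=
  (mem_rootsOfUnity' 3 (a : kˣ)).1 a.2

variable (q : k)

/-- The diagonal endomorphism of `B_q` attached to a pair of cube roots of unity. -/
def diagHom (p : rootsOfUnity 3 k × rootsOfUnity 3 k) : AlgB q →ₐ[k] AlgB q :=
  liftHom (((p.1 : kˣ) : k) • gx q) (((p.2 : kˣ) : k) • gy q)
    -- This scalar is `(ab)⁻¹`, written without inverses; `a³ = b³ = 1` makes it compatible with
    -- both inhomogeneous relations.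
    ((((p.1 : kˣ) : k) * ((p.2 : kˣ) : k)) ^ 2 • gz q)
    (by
      rw [smul_mul_smul_comm, smul_mul_smul_comm, gx_mul_gy]
      module)
    (by
      rw [smul_mul_smul_comm, smul_mul_smul_comm, smul_pow, gz_mul_gx, smul_add]
      congr 1
      · module
      · congr 1
        linear_combination ((p.2 : kˣ) : k) ^ 2 * rootsOfUnity_pow_three p.1)
    (by
      rw [smul_mul_smul_comm, smul_mul_smul_comm, smul_pow, gz_mul_gy, smul_add]
      congr 1
      · module
      · congr 1
        linear_combination ((p.1 : kˣ) : k) ^ 2 * rootsOfUnity_pow_three p.2)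

lemma diagHom_gens (p : rootsOfUnity 3 k × rootsOfUnity 3 k) :
    diagHom q p (gx q) = ((p.1 : kˣ) : k) • gx q ∧ diagHom q p (gy q) = ((p.2 : kˣ) : k) • gy q ∧
      diagHom q p (gz q) = (((p.1 : kˣ) : k) * ((p.2 : kˣ) : k)) ^ 2 • gz q :=
  liftHom_gens _ _ _

/-- The action of pairs of cube roots of unity on `B_q` by diagonal automorphisms. -/
def diagAut : rootsOfUnity 3 k × rootsOfUnity 3 k →* (AlgB q ≃ₐ[k] AlgB q) :=
  -- A monoid homomorphism from a group to endomorphisms lands in the units, so invertibility needs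
  -- no separate check.
  (AlgEquiv.algHomUnitsEquiv k (AlgB q)).toMonoidHom.comp (MonoidHom.toHomUnits
    { toFun := diagHom q
      map_one' := by
        obtain ⟨hx, hy, hz⟩ := diagHom_gens q 1
        exact algHom_ext (by simp [hx]) (by simp [hy]) (by simp [hz])
      map_mul' := fun p p' => by
        obtain ⟨hx, hy, hz⟩ := diagHom_gens q p
        obtain ⟨hx', hy', hz'⟩ := diagHom_gens q p'
        obtain ⟨hx'', hy'', hz''⟩ := diagHom_gens q (p * p')
        refine algHom_ext ?_ ?_ ?_
        · rw [hx'', AlgHom.mul_apply, hx', map_smul, hx, smul_smul, mul_comm]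
          simp
        · rw [hy'', AlgHom.mul_apply, hy', map_smul, hy, smul_smul, mul_comm]
          simp
        · rw [hz'', AlgHom.mul_apply, hz', map_smul, hz, smul_smul]
          congr 1
          simp
          ring })

lemma diagAut_apply (p : rootsOfUnity 3 k × rootsOfUnity 3 k) (u : AlgB q) :
    diagAut q p u = diagHom q p u := rfl

end diagonal

/-! ### The diagonal automorphisms as the ozone group. -/

section ozone
variable {q : kˣ}

lemma smul_injective_of_embed (hq : (q : k) ^ 3 ≠ 1) {u : AlgB (q : k)} {g : Exponent}
    (hu : embed hq u = mon _ g 1) {a b : k} (h : a • u = b • u) : a = b := by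
  have := congr(coeff g (embed hq $h))
  simpa only [map_smul, hu, coeff_mon_self, smul_eq_mul, mul_one] using this

lemma diagAut_injective (hq : (q : k) ^ 3 ≠ 1) : Function.Injective (diagAut (q : k)) := by
  intro p p' h
  obtain ⟨hx, hy, -⟩ := diagHom_gens (q : k) p
  obtain ⟨hx', hy', -⟩ := diagHom_gens (q : k) p'
  rw [← diagAut_apply] at hx hy hx' hy'
  rw [h] at hx hy
  refine Prod.ext (Subtype.ext (Units.ext ?_)) (Subtype.ext (Units.ext ?_))
  · exact smul_injective_of_embed hq (embed_gx hq) (hx.symm.trans hx')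
  · exact smul_injective_of_embed hq (embed_gy hq) (hy.symm.trans hy')

/-- The character `g ↦ a ^ xdeg g * b ^ ydeg g`. -/
def character (a b : kˣ) : Exponent →+ Additive kˣ :=
  AddMonoidHom.mk' (fun g => Additive.ofMul (a ^ xdeg g * b ^ ydeg g)) fun g g' => by
    rw [← ofMul_mul, map_add, map_add, zpow_add, zpow_add, mul_mul_mul_comm]

/-- All three terms of `tz` have the same character value `(ab)⁻¹`, because `a² = a⁻¹` and `b² =
b⁻¹`; the action thus becomes a grading-preserving scaling of the torus. -/
lemma embed_diagHom (hq : (q : k) ^ 3 ≠ 1) (p : rootsOfUnity 3 k × rootsOfUnity 3 k)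
    (u : AlgB (q : k)) :
    embed hq (diagHom (q : k) p u) = scale (character p.1 p.2) (embed hq u) := by
  obtain ⟨hx, hy, hz⟩ := diagHom_gens (q : k) p
  have inv_eq (a : rootsOfUnity 3 k) : ((a : kˣ) : k)⁻¹ = ((a : kˣ) : k) ^ 2 :=
    inv_eq_of_mul_eq_one_left (by rw [← pow_succ]; exact rootsOfUnity_pow_three a)
  have key : (embed hq).comp (diagHom (q : k) p)
      = (scale (character p.1 p.2)).comp (embed hq) := by
    refine algHom_ext ?_ ?_ ?_
    · rw [AlgHom.comp_apply, AlgHom.comp_apply, hx, map_smul, embed_gx, scale_mon, ← map_smul]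
      simp [character]
    · rw [AlgHom.comp_apply, AlgHom.comp_apply, hy, map_smul, embed_gy, scale_mon, ← map_smul]
      simp [character]
    · rw [AlgHom.comp_apply, AlgHom.comp_apply, hz, map_smul, embed_gz, tz]
      simp only [map_add, scale_mon, smul_add, ← map_smul]
      congr 2
      · simp [character, inv_eq, mul_pow]
      · simp [character, inv_eq, mul_pow]
      · simp [character, inv_eq, mul_pow]
  exact DFunLike.congr_fun key u

/-- Commuting with `y` constrains the `x`-degree and commuting with `x` the `y`-degree; primitivity
of `q` turns each into divisibility. -/
lemma dvd_of_mem_center (hq3 : (q : k) ^ 3 ≠ 1) {n : ℕ} (hq : IsPrimitiveRoot q n)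
    {u : AlgB (q : k)} (hu : u ∈ Subalgebra.center k (AlgB (q : k))) {g : Exponent}
    (hg : coeff g (embed hq3 u) ≠ 0) : (n : ℤ) ∣ xdeg g ∧ (n : ℤ) ∣ ydeg g := by
  have hc := Subalgebra.mem_center_iff.1 hu
  constructor
  · have h := cocycle_eq_of_comm (u := embed hq3 u) (h := mk 0 0 1)
      (by rw [← embed_gy hq3, ← map_mul, hc, map_mul]) hg
    rw [cocycle_bichar, cocycle_bichar] at h
    rw [← hq.zpow_eq_one_iff_dvd, ← inv_eq_one, ← zpow_neg]
    refine Units.ext ?_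
    simpa using h.symm
  · have h := cocycle_eq_of_comm (u := embed hq3 u) (h := mk 0 1 0)
      (by rw [← embed_gx hq3, ← map_mul, hc, map_mul]) hg
    rw [cocycle_bichar, cocycle_bichar] at h
    rw [← hq.zpow_eq_one_iff_dvd, ← inv_eq_one, ← zpow_neg]
    refine Units.ext ?_
    simpa using h

/-- If `3` divides the order of `q`, the diagonal automorphisms form the ozone group of `B_q`. -/
lemma range_diagAut (hq3 : (q : k) ^ 3 ≠ 1) {n : ℕ} (hn0 : n ≠ 0) (hq : IsPrimitiveRoot q n)
    (h3 : 3 ∣ n) : (diagAut (q : k)).range = ozoneGroup k (AlgB (q : k)) := by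
  ext σ
  constructor
  · rintro ⟨p, rfl⟩ u hu
    refine embed_injective hq3 ?_
    rw [diagAut_apply, embed_diagHom]
    ext g
    rw [coeff_scale]
    by_cases hg : coeff g (embed hq3 u) = 0
    · rw [hg, mul_zero]
    · obtain ⟨hx, hy⟩ := dvd_of_mem_center hq3 hq hu hg
      have hone (a : rootsOfUnity 3 k) {m : ℤ} (hm : (n : ℤ) ∣ m) : (a : kˣ) ^ m = 1 := by
        obtain ⟨d, rfl⟩ := (Int.natCast_dvd_natCast.2 h3).trans hm
        have h' : (a : kˣ) ^ 3 = 1 := a.2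
        rw [zpow_mul, zpow_natCast, h', one_zpow]
      simp [character, hone _ hx, hone _ hy]
  · intro hσ
    obtain ⟨a, b, -, -, ha, hb, hx, hy, hz⟩ := exists_of_mem_ozoneGroup hq3 hn0
      (by rw [← Units.val_pow_eq_pow_val, hq.pow_eq_one, Units.val_one]) hσ
    refine ⟨(rootsOfUnity.mkOfPowEq a ha, rootsOfUnity.mkOfPowEq b hb), ?_⟩
    obtain ⟨hx', hy', hz'⟩ := diagHom_gens (q : k)
      (rootsOfUnity.mkOfPowEq a ha, rootsOfUnity.mkOfPowEq b hb)
    refine algEquiv_ext ?_ ?_ ?_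
    · rw [diagAut_apply, hx', hx, rootsOfUnity.val_mkOfPowEq_coe]
    · rw [diagAut_apply, hy', hy, rootsOfUnity.val_mkOfPowEq_coe]
    · rw [diagAut_apply, hz', rootsOfUnity.val_mkOfPowEq_coe,
        rootsOfUnity.val_mkOfPowEq_coe]
      -- Writing `z` as `(ab) σ(z)` leaves the total scalar `(ab)³ = 1`.
      nth_rw 1 [← hz]
      rw [smul_smul, ← pow_succ, mul_pow, ha, hb, one_mul, one_smul]

end ozone
end
end AlgB

/-- The group of `m`-th roots of unity is cyclic of order `m` if there is a primitive one. -/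
noncomputable def rootsOfUnityEquivZMod {k : Type*} [Field k] {m : ℕ} [NeZero m] {ζ : kˣ}
    (hζ : IsPrimitiveRoot ζ m) : rootsOfUnity m k ≃* Multiplicative (ZMod m) :=
  (MulEquiv.subgroupCongr hζ.zpowers_eq.symm).trans
    (AddEquiv.toMultiplicativeLeft hζ.zmodEquivZPowers).symm

theorem proposition1p7 {k : Type*} [Field k] [CharZero k] (q : k) (n : ℕ) (hn : 0 < n)
    (hq : IsPrimitiveRoot q n) (hn1 : n ≠ 1) (hn3 : n ≠ 3) :
    (¬ 3 ∣ n → ozoneGroup k (AlgB q) = ⊥) ∧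
    (3 ∣ n → Nonempty
      (ozoneGroup k (AlgB q) ≃* Multiplicative (ZMod 3) × Multiplicative (ZMod 3))) := by
  have hq3 : q ^ 3 ≠ 1 := fun h => by
    rcases (Nat.dvd_prime Nat.prime_three).1 (hq.dvd_of_pow_eq_one 3 h) with h | h
    · exact hn1 h
    · exact hn3 h
  obtain ⟨q, rfl⟩ := hq.isUnit hn.ne'
  have hqu : IsPrimitiveRoot q n := IsPrimitiveRoot.coe_units_iff.1 hq
  refine ⟨AlgB.ozoneGroup_eq_bot hq3 hn.ne' hq.pow_eq_one, fun h3 => ?_⟩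
  have hζ : IsPrimitiveRoot (q ^ (n / 3)) 3 :=
    hqu.pow hn (Nat.div_mul_cancel h3).symm
  exact ⟨((MulEquiv.subgroupCongr (AlgB.range_diagAut hq3 hn.ne' hqu h3).symm).trans
    (MonoidHom.ofInjective (AlgB.diagAut_injective hq3)).symm).trans
      ((rootsOfUnityEquivZMod hζ).prodCongr (rootsOfUnityEquivZMod hζ))⟩
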